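/- Let $d\ge 1$, and let $\mu,\nu$ be Borel probability measures on $\mathbb{R}^d$ with finite first moments, $\mu$ being absolutely continuous with respect to Lebesgue measure. Let $MT(\mu,\nu)$ be the set of Borel probability measures $\pi$ on $\mathbb{R}^d\times\mathbb{R}^d$ with marginals $\mu$ and $\nu$ whose disintegration $d\pi(x,y)=d\pi_x(y)\,d\mu(x)$ satisfies that $\pi_x$ has barycenter $x$ for $\mu$-a.e. $x$. Let $c(x,y)=|x-y|$ or $c(x,y)=-|x-y|$, and let $\pi$ be a minimizer, or a maximizer, of $\int c\,d\pi$ over $MT(\mu,\nu)$. If $\pi$ minimizes $\int|x-y|\,d\pi$ (that is, in the minimization problem for $c=|x-y|$ and in the maximization problem for $c=-|x-y|$), assume moreover that $\mu$ and $\nu$ are mutually singular ($\mu\wedge\nu=0$). Let $B\subset\mathbb{R}^d$ be a Borel set, let $\pi_B$ be the restriction of $\pi$ to $B\times\mathbb{R}^d$, and let $\mu_B,\nu_B$ be the first and second marginals of $\pi_B$. Suppose that $\pi$ admits a $c$-dual on $B$: there are measurable functions $\alpha:B\to\mathbb{R}$, $\gamma:B\to\mathbb{R}^d$ and $\beta:\mathbb{R}^d\to\mathbb{R}$,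 with $\alpha\in L^1(\mu_B)$ and $\beta\in L^1(\nu_B)$, such that $$\beta(y)-\alpha(x)-\gamma(x)\cdot(y-x)\le c(x,y)\qquad\text{for all }(x,y)\in B\times\mathbb{R}^d$$ in the case of minimization, and with $\ge$ in place of $\le$ in the case of maximization, and such that $$\int\beta\,d\nu_B-\int\alpha\,d\mu_B=\int c\,d\pi_B .$$ Then, for $\mu$-a.e. $x\in B$, $\operatorname{supp}\pi_x=\operatorname{Ext}\big(\operatorname{conv}(\operatorname{supp}\pi_x)\big)$, where $\operatorname{conv}$ is the convex hull and $\operatorname{Ext}$ the set of extreme points. -/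

import Mathlib

open MeasureTheory ProbabilityTheory Set

namespace MartingaleTransport

/-- The two optimization problems. -/
inductive Sense where
  | minimize
  | maximize

section Plans

variable {d : ℕ}

/-- The cost functions `±|x - y|`, with `σ = 1` or `σ = -1`. -/
noncomputable def distCost (σ : ℝ) (x y : EuclideanSpace ℝ (Fin d)) : ℝ := σ * ‖x - y‖

/-- `κ` is a disintegration `(π_x)` of `π` with respect to `μ`, i.e. `dπ(x,y) = dπ_x(y) dμ(x)`,
where each `π_x = κ x` is a probability measure. -/
structure IsDisintegration (π : Measure (EuclideanSpace ℝ (Fin d) × EuclideanSpace ℝ (Fin d)))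
    (μ : Measure (EuclideanSpace ℝ (Fin d)))
    (κ : Kernel (EuclideanSpace ℝ (Fin d)) (EuclideanSpace ℝ (Fin d))) : Prop where
  isMarkov : IsMarkovKernel κ
  eq_compProd : π = μ ⊗ₘ κ

/-- `MT(μ, ν)`: the probability measures `π` on `ℝ^d × ℝ^d` with marginals `μ` and `ν` whose
disintegration satisfies that `π_x` has barycenter `x` for `μ`-almost every `x`. -/
def MT (μ ν : Measure (EuclideanSpace ℝ (Fin d))) :
    Set (Measure (EuclideanSpace ℝ (Fin d) × EuclideanSpace ℝ (Fin d))) :=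
  {π | IsProbabilityMeasure π ∧ π.map Prod.fst = μ ∧ π.map Prod.snd = ν ∧
    ∃ κ, IsDisintegration π μ κ ∧
      ∀ᵐ x ∂μ, Integrable (fun y => y) (κ x) ∧ ∫ y, y ∂(κ x) = x}

/-- `π` solves the minimization (resp. maximization) problem for the cost `c` over `MT(μ, ν)`. -/
def IsOptimal (s : Sense) (c : EuclideanSpace ℝ (Fin d) → EuclideanSpace ℝ (Fin d) → ℝ)
    (μ ν : Measure (EuclideanSpace ℝ (Fin d)))
    (π : Measure (EuclideanSpace ℝ (Fin d) × EuclideanSpace ℝ (Fin d))) : Prop :=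
  π ∈ MT μ ν ∧ ∀ π' ∈ MT μ ν,
    match s with
    | .minimize => ∫ p, c p.1 p.2 ∂π ≤ ∫ p, c p.1 p.2 ∂π'
    | .maximize => ∫ p, c p.1 p.2 ∂π' ≤ ∫ p, c p.1 p.2 ∂π

/-- Admissible triples: `(α, γ, β) ∈ E_m(c, X, Y)` (for minimization), resp.
`(α, γ, β) ∈ E_M(c, X, Y)` (for maximization), where `α : X → ℝ`, `γ : X → ℝ^d` and `β : Y → ℝ`
are measurable. Only the values of `α`, `γ` on `X` and those of `β` on `Y` matter. -/
structure IsAdmissible (s : Sense)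
    (c : EuclideanSpace ℝ (Fin d) → EuclideanSpace ℝ (Fin d) → ℝ)
    (X Y : Set (EuclideanSpace ℝ (Fin d)))
    (α : EuclideanSpace ℝ (Fin d) → ℝ)
    (γ : EuclideanSpace ℝ (Fin d) → EuclideanSpace ℝ (Fin d))
    (β : EuclideanSpace ℝ (Fin d) → ℝ) : Prop where
  measurable_α : Measurable (X.domRestrict α)
  measurable_γ : Measurable (X.domRestrict γ)
  measurable_β : Measurable (Y.domRestrict β)
  ineq : ∀ x ∈ X, ∀ y ∈ Y,
    match s with
    | .minimize => β y - α x - inner ℝ (γ x) (y - x) ≤ c x y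
    | .maximize => c x y ≤ β y - α x - inner ℝ (γ x) (y - x)

/-- The restriction `π_B` of `π` to `B × ℝ^d`. -/
noncomputable def restrictPlan
    (π : Measure (EuclideanSpace ℝ (Fin d) × EuclideanSpace ℝ (Fin d)))
    (B : Set (EuclideanSpace ℝ (Fin d))) :
    Measure (EuclideanSpace ℝ (Fin d) × EuclideanSpace ℝ (Fin d)) :=
  π.restrict (B ×ˢ univ)

/-- `π` admits a `c`-dual on `B`: there is an admissible triple on `B × ℝ^d` with
`∫ β dν_B - ∫ α dμ_B = ∫ c dπ_B`, where `μ_B`, `ν_B` are the marginals of `π_B`.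
The integrals are required to exist. -/
def AdmitsDual (s : Sense) (c : EuclideanSpace ℝ (Fin d) → EuclideanSpace ℝ (Fin d) → ℝ)
    (π : Measure (EuclideanSpace ℝ (Fin d) × EuclideanSpace ℝ (Fin d)))
    (B : Set (EuclideanSpace ℝ (Fin d))) : Prop :=
  ∃ (α : EuclideanSpace ℝ (Fin d) → ℝ)
    (γ : EuclideanSpace ℝ (Fin d) → EuclideanSpace ℝ (Fin d))
    (β : EuclideanSpace ℝ (Fin d) → ℝ),
    IsAdmissible s c B univ α γ β ∧
    Integrable β ((restrictPlan π B).map Prod.snd) ∧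
    Integrable α ((restrictPlan π B).map Prod.fst) ∧
    Integrable (fun p => c p.1 p.2) (restrictPlan π B) ∧
    ∫ y, β y ∂((restrictPlan π B).map Prod.snd) - ∫ x, α x ∂((restrictPlan π B).map Prod.fst)
      = ∫ p, c p.1 p.2 ∂(restrictPlan π B)

end Plans

end MartingaleTransport

open MartingaleTransport

/-! Changing signs turns maximization into minimization, so the cost is `τ ‖x - y‖` with `τ = ±1`. A
dual without gap is touched: for a.e. `x ∈ B`, equality holds at `κ x`-a.e. `y`
(`ae_touching_of_integral_eq`). Subtracting the inequality at `x'` from the equality at `x` bounds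
`τ (‖x - y‖ - ‖x' - y‖)` by an affine function of `y`. Averaging over `κ x`, with barycenter `x`,
removes its linear part. Hence `α` is Lipschitz where `γ` is bounded, so differentiable there at
a.e. point, and absolute continuity of `μ` transfers this to `μ`.

Let `x'` tend to `x` in direction `ω`, with `γ x'` tending to `γ x`. The mean slope of the distance
is then at most a linear function of `ω`. If `κ x` has no atom at `x`, both sides are odd in `ω`, so
equality holds. The gaps are nonnegative with mean tending to `0`, so the slope is a limit of affine
functions, hence affine in `y` (`slope_le_and_affine_of_eq`). For `τ = -1` the same inequality
excludes the atom; for `τ = 1` mutual singularity does.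

Thus the unit vector from `y` to `x` is a.e. an affine function of `y`, and strict convexity of the
ball makes every support point extreme (`mem_extremePoints_convexHull_of_affine`). -/

namespace MartingaleTransport

open Filter Topology Metric

/-! ### Limits of affine functions and density points -/

section Analysis

variable {E : Type*} [NormedAddCommGroup E] [InnerProductSpace ℝ E] [FiniteDimensional ℝ E]

/-- A pointwise limit on `Z` of affine functions is the restriction to `Z` of an affine function. -/
theorem exists_affine_of_tendsto (Z : Set E) (x : E) (a : ℕ → ℝ) (g : ℕ → E) (D : E → ℝ)
    (h : ∀ y ∈ Z, Tendsto (fun k => a k + inner ℝ (g k) (y - x)) atTop (𝓝 (D y))) :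
    ∃ (b : ℝ) (v : E), ∀ y ∈ Z, D y = b + inner ℝ v (y - x) := by
  let Φ : (ℝ × E) →ₗ[ℝ] (Z → ℝ) :=
    { toFun := fun p y => p.1 + inner ℝ p.2 ((y : E) - x)
      map_add' := by
        intro p q; ext y; simp only [Prod.fst_add, Prod.snd_add, inner_add_left, Pi.add_apply]; ring
      map_smul' := by
        intro c p; ext y
        simp only [Prod.smul_fst, Prod.smul_snd, inner_smul_left, Pi.smul_apply, smul_eq_mul,
          RingHom.id_apply, conj_trivial]
        ring }
  -- Finite dimension makes the range closed for pointwise convergence, so `a k` and `g k`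
  -- themselves need not converge.
  have hcl : IsClosed (LinearMap.range Φ : Set (Z → ℝ)) :=
    Submodule.closed_of_finiteDimensional _
  have hlim : Tendsto (fun k => Φ (a k, g k)) atTop (𝓝 (fun y : Z => D y)) :=
    tendsto_pi_nhds.2 fun y => h y y.2
  obtain ⟨p, hp⟩ := hcl.mem_of_tendsto hlim (Eventually.of_forall fun k => ⟨_, rfl⟩)
  exact ⟨p.1, p.2, fun y hy => (congrFun hp ⟨y, hy⟩).symm⟩

/-- At almost every point `x` of an arbitrary set `s`, every direction is approximated by points
of `s` tending to `x` along which `g` converges to `g x`. -/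
theorem ae_exists_seq_tendsto_direction [MeasurableSpace E] [BorelSpace E] (μ : Measure E)
    [μ.IsAddHaarMeasure] {F : Type*} [PseudoMetricSpace F] [SecondCountableTopology F]
    (s : Set E) (g : E → F) :
    ∀ᵐ x ∂μ, x ∈ s → ∀ ω : E, ∃ (w : ℕ → E) (r : ℕ → ℝ), (∀ k, 0 < r k) ∧
      Tendsto r atTop (𝓝 0) ∧ Tendsto w atTop (𝓝 ω) ∧ (∀ k, x + r k • w k ∈ s) ∧
      Tendsto (fun k => g (x + r k • w k)) atTop (𝓝 (g x)) := by
  -- Almost every point of `s ∩ g ⁻¹' U` is a density point of it, without measurability; a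
  -- countable basis leaves a single null set.
  have hdens : ∀ U ∈ TopologicalSpace.countableBasis F, ∀ᵐ x ∂μ, x ∈ s ∩ g ⁻¹' U →
      Tendsto (fun r => μ ((s ∩ g ⁻¹' U) ∩ closedBall x r) / μ (closedBall x r))
        (𝓝[>] 0) (𝓝 1) := fun U _ =>
    ae_imp_of_ae_restrict (Besicovitch.ae_tendsto_measure_inter_div μ _)
  filter_upwards [(ae_ball_iff (TopologicalSpace.countable_countableBasis F)).2 hdens]
    with x hx hxs ω
  have key : ∀ k : ℕ, ∃ (w : E) (r : ℝ), 0 < r ∧ r < 1 / (k + 1) ∧ dist w ω < 1 / (k + 1) ∧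
      x + r • w ∈ s ∧ dist (g (x + r • w)) (g x) < 1 / (k + 1) := by
    intro k
    have hk : (0 : ℝ) < 1 / (k + 1) := by positivity
    obtain ⟨U, hU, hxU, hUb⟩ := (TopologicalSpace.isBasis_countableBasis F).exists_subset_of_mem_open
      (mem_ball_self hk : g x ∈ ball (g x) _) isOpen_ball
    have h1 := Measure.eventually_nonempty_inter_smul_of_density_one μ _ x
      (hx U hU ⟨hxs, hxU⟩) (ball ω (1 / (k + 1))) measurableSet_ball (measure_ball_pos μ ω hk).ne'
    have h2 : ∀ᶠ r in 𝓝[>] (0 : ℝ), r ∈ Ioo 0 (1 / ((k : ℝ) + 1)) := Ioo_mem_nhdsGT hk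
    obtain ⟨r, ⟨z, ⟨hzs, hzU⟩, hz⟩, hr0, hr1⟩ := (h1.and h2).exists
    obtain ⟨x', hx', v, hv, rfl⟩ := Set.mem_add.1 hz
    obtain ⟨w, hw, rfl⟩ := Set.mem_smul_set.1 hv
    rw [mem_singleton_iff] at hx'
    subst hx'
    exact ⟨w, r, hr0, hr1, mem_ball.1 hw, hzs, mem_ball.1 (hUb hzU)⟩
  choose w r hr0 hr1 hw hs hg using key
  refine ⟨w, r, hr0, ?_, ?_, hs, ?_⟩
  · exact squeeze_zero (fun k => (hr0 k).le) (fun k => (hr1 k).le)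
      tendsto_one_div_add_atTop_nhds_zero_nat
  · exact tendsto_iff_dist_tendsto_zero.2 (squeeze_zero (fun k => dist_nonneg)
      (fun k => (hw k).le) tendsto_one_div_add_atTop_nhds_zero_nat)
  · exact tendsto_iff_dist_tendsto_zero.2 (squeeze_zero (fun k => dist_nonneg)
      (fun k => (hg k).le) tendsto_one_div_add_atTop_nhds_zero_nat)

end Analysis

/-! ### Directional slopes of the distance and their means -/

section Slope

variable {E : Type*} [NormedAddCommGroup E] [InnerProductSpace ℝ E]

/-- The unit vector pointing from `y` to `x`, with value `0` for `y = x`. -/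
noncomputable def unitVec (x y : E) : E := ‖x - y‖⁻¹ • (x - y)

/-- Minus the one-sided directional derivative at `x` in the direction `ω` of the distance
to `y`. -/
noncomputable def negSlope (x ω y : E) : ℝ :=
  -inner ℝ (unitVec x y) ω - ({x} : Set E).indicator (fun _ => ‖ω‖) y

theorem norm_unitVec_le (x y : E) : ‖unitVec x y‖ ≤ 1 := by
  rw [unitVec, norm_smul, norm_inv, norm_norm]
  exact inv_mul_le_one

theorem tendsto_slope_dist (x ω y : E) (w : ℕ → E) (r : ℕ → ℝ) (hr : ∀ k, 0 < r k)
    (hr0 : Tendsto r atTop (𝓝 0)) (hw : Tendsto w atTop (𝓝 ω)) :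
    Tendsto (fun k => (‖x - y‖ - ‖x + r k • w k - y‖) / r k) atTop (𝓝 (negSlope x ω y)) := by
  by_cases hy : y = x
  · subst hy
    have h : (fun k => (‖y - y‖ - ‖y + r k • w k - y‖) / r k) = fun k => -‖w k‖ := by
      funext k
      rw [sub_self, norm_zero, add_sub_cancel_left, norm_smul, Real.norm_of_nonneg (hr k).le]
      field_simp [(hr k).ne']
      ring
    rw [h]
    simp only [negSlope, unitVec, sub_self, smul_zero, inner_zero_left, neg_zero, zero_sub,
      mem_singleton_iff, indicator_of_mem]
    exact hw.norm.neg
  · have hv : 0 < ‖x - y‖ := norm_pos_iff.2 (sub_ne_zero.2 (Ne.symm hy))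
    -- Multiplying by the sum of the two norms cancels the factor `r k`.
    have h : ∀ k, (‖x - y‖ - ‖x + r k • w k - y‖) / r k =
        -(2 * inner ℝ (x - y) (w k) + r k * ‖w k‖ ^ 2) / (‖x - y‖ + ‖x - y + r k • w k‖) := by
      intro k
      have h1 : x + r k • w k - y = x - y + r k • w k := by abel
      have h2 := norm_add_sq_real (x - y) (r k • w k)
      rw [inner_smul_right, norm_smul, Real.norm_of_nonneg (hr k).le] at h2
      have h3 : 0 < ‖x - y‖ + ‖x - y + r k • w k‖ := by positivity
      rw [h1, div_eq_div_iff (hr k).ne' h3.ne']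
      linear_combination -h2
    have hlim : Tendsto (fun k => -(2 * inner ℝ (x - y) (w k) + r k * ‖w k‖ ^ 2) /
        (‖x - y‖ + ‖x - y + r k • w k‖)) atTop (𝓝 (-(2 * inner ℝ (x - y) ω + 0 * ‖ω‖ ^ 2) /
        (‖x - y‖ + ‖x - y + (0 : ℝ) • ω‖))) := by
      refine Tendsto.div ?_ ?_ (by simp only [zero_smul, add_zero]; positivity)
      · exact (((tendsto_const_nhds.inner hw).const_mul 2).add (hr0.mul (hw.norm.pow 2))).neg
      · exact tendsto_const_nhds.add (tendsto_const_nhds.add (hr0.smul hw)).norm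
    simp only [h]
    convert hlim using 2
    simp only [negSlope, unitVec, inner_smul_left, mem_singleton_iff, hy, not_false_eq_true,
      indicator_of_notMem, zero_smul, add_zero, zero_mul, conj_trivial, sub_zero]
    field_simp
    ring

theorem abs_slope_dist_le (x w y : E) {r : ℝ} (hr : 0 < r) :
    |(‖x - y‖ - ‖x + r • w - y‖) / r| ≤ ‖w‖ := by
  rw [abs_div, abs_of_pos hr, div_le_iff₀ hr]
  refine (abs_norm_sub_norm_le _ _).trans (le_of_eq ?_)
  have : x - y - (x + r • w - y) = -(r • w) := by abel
  rw [this, norm_neg, norm_smul, Real.norm_of_nonneg hr.le, mul_comm]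

variable [MeasurableSpace E]

theorem integrable_affine {P : Measure E} [IsProbabilityMeasure P]
    (hint : Integrable (fun y => y) P) (x : E) (a : ℝ) (g : E) :
    Integrable (fun y => a + inner ℝ g (y - x)) P :=
  (integrable_const a).add ((hint.sub (integrable_const x)).const_inner g)

/-- Gradient terms vanish in the mean at the barycenter; this is how `γ` drops out of averaged
inequalities. -/
theorem integral_affine [CompleteSpace E] {P : Measure E} [IsProbabilityMeasure P]
    (hint : Integrable (fun y => y) P) {x : E} (hbar : ∫ y, y ∂P = x) (a : ℝ) (g : E) :
    ∫ y, a + inner ℝ g (y - x) ∂P = a := by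
  have h : Integrable (fun y => y - x) P := hint.sub (integrable_const x)
  rw [integral_add (integrable_const a) (h.const_inner g), integral_inner h g,
    integral_sub hint (integrable_const x), hbar]
  simp

variable [BorelSpace E] [FiniteDimensional ℝ E]

theorem measurable_unitVec (x : E) : Measurable (unitVec x) := by
  unfold unitVec
  have : Measurable fun y : E => x - y := by fun_prop
  exact (this.norm.inv).smul this

theorem measurable_negSlope (x ω : E) : Measurable (negSlope x ω) := by
  unfold negSlope
  have := (measurable_unitVec x).inner (measurable_const (a := ω)) (𝕜 := ℝ)
  exact this.neg.sub (measurable_const.indicator (measurableSet_singleton x))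

theorem integrable_unitVec (P : Measure E) [IsProbabilityMeasure P] (x : E) :
    Integrable (unitVec x) P :=
  Integrable.of_bound (measurable_unitVec x).aestronglyMeasurable 1
    (Eventually.of_forall fun y => norm_unitVec_le x y)

theorem integrable_negSlope (P : Measure E) [IsProbabilityMeasure P] (x ω : E) :
    Integrable (negSlope x ω) P := by
  unfold negSlope
  exact ((integrable_unitVec P x).inner_const ω).neg.sub
    ((integrable_const _).indicator (measurableSet_singleton x))

theorem integral_negSlope (P : Measure E) [IsProbabilityMeasure P] (x ω : E) :
    ∫ y, negSlope x ω y ∂P = -inner ℝ (∫ y, unitVec x y ∂P) ω - P.real {x} * ‖ω‖ := by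
  unfold negSlope
  have h1 : Integrable (fun y => -inner ℝ (unitVec x y) ω) P :=
    ((integrable_unitVec P x).inner_const ω).neg
  rw [integral_sub h1 ((integrable_const _).indicator (measurableSet_singleton x)), integral_neg,
    integral_indicator_const _ (measurableSet_singleton x), smul_eq_mul]
  congr 2
  simp_rw [real_inner_comm ω]
  exact integral_inner (integrable_unitVec P x) ω

/-- If affine functions with values `a k` at the barycenter dominate the increments of
`τ ‖x - y‖` along a sequence approaching `x` in the direction `ω`, then the limiting slope of the
values dominates the mean slope, and in the case of equality the slope is affine in `y`. -/
theorem slope_le_and_affine_of_eq {P : Measure E} [IsProbabilityMeasure P]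
    (hint : Integrable (fun y => y) P) {x : E} (hbar : ∫ y, y ∂P = x) (τ : ℝ) {ω : E}
    {w : ℕ → E} {r : ℕ → ℝ} (hr : ∀ k, 0 < r k) (hr0 : Tendsto r atTop (𝓝 0))
    (hw : Tendsto w atTop (𝓝 ω)) {a : ℕ → ℝ} {g : ℕ → E} {l : ℝ}
    (ha : Tendsto (fun k => a k / r k) atTop (𝓝 l))
    (hle : ∀ k, ∀ᵐ y ∂P, τ * (‖x - y‖ - ‖x + r k • w k - y‖) ≤ a k + inner ℝ (g k) (y - x)) :
    τ * ∫ y, negSlope x ω y ∂P ≤ l ∧ (τ * ∫ y, negSlope x ω y ∂P = l →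
      ∃ (b : ℝ) (v : E), ∀ᵐ y ∂P, τ * negSlope x ω y = b + inner ℝ v (y - x)) := by
  set D : ℕ → E → ℝ := fun k y => (‖x - y‖ - ‖x + r k • w k - y‖) / r k with hD
  have hDm : ∀ k, AEStronglyMeasurable (D k) P := fun k => by
    have : Continuous (D k) := by simp only [hD]; fun_prop
    exact this.aestronglyMeasurable
  obtain ⟨C, hC⟩ := hw.norm.bddAbove_range
  have hDC : ∀ k y, ‖D k y‖ ≤ C := fun k y =>
    (abs_slope_dist_le x (w k) y (hr k)).trans (hC ⟨k, rfl⟩)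
  have hDi : ∀ k, Integrable (D k) P := fun k =>
    Integrable.of_bound (hDm k) C (Eventually.of_forall (hDC k))
  have hDlim : ∀ y, Tendsto (fun k => D k y) atTop (𝓝 (negSlope x ω y)) := fun y =>
    tendsto_slope_dist x ω y w r hr hr0 hw
  have hIlim : Tendsto (fun k => ∫ y, D k y ∂P) atTop (𝓝 (∫ y, negSlope x ω y ∂P)) :=
    tendsto_integral_of_dominated_convergence (fun _ => C) hDm (integrable_const C)
      (fun k => Eventually.of_forall (hDC k)) (Eventually.of_forall hDlim)
  set A : ℕ → E → ℝ := fun k y => a k / r k + inner ℝ ((r k)⁻¹ • g k) (y - x) with hA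
  have hAi : ∀ k, Integrable (A k) P := fun k => integrable_affine hint x _ _
  have hAI : ∀ k, ∫ y, A k y ∂P = a k / r k := fun k => integral_affine hint hbar _ _
  have hDA : ∀ k, ∀ᵐ y ∂P, 0 ≤ A k y - τ * D k y := fun k => by
    filter_upwards [hle k] with y hy
    have : A k y - τ * D k y = (a k + inner ℝ (g k) (y - x) -
        τ * (‖x - y‖ - ‖x + r k • w k - y‖)) / r k := by
      simp only [hA, hD, inner_smul_left, conj_trivial]
      have := (hr k).ne'
      field_simp
    rw [this]
    exact div_nonneg (sub_nonneg.2 hy) (hr k).le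
  have hdiff : ∀ k, ∫ y, A k y - τ * D k y ∂P = a k / r k - τ * ∫ y, D k y ∂P := fun k => by
    rw [integral_sub (hAi k) ((hDi k).const_mul τ), hAI, integral_const_mul]
  have hlim := ha.sub (hIlim.const_mul τ)
  refine ⟨?_, fun heq => ?_⟩
  · refine sub_nonneg.1 (ge_of_tendsto' hlim fun k => ?_)
    rw [← hdiff]
    exact integral_nonneg_of_ae (hDA k)
  · rw [heq, sub_self] at hlim
    -- For these nonnegative gaps the `L¹` norm is the integral, which tends to `0`; a subsequence
    -- then converges a.e.
    have hmeas : TendstoInMeasure P (fun k y => A k y - τ * D k y) atTop (fun _ => 0) := by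
      refine tendstoInMeasure_of_tendsto_eLpNorm one_ne_zero
        (fun k => ((hAi k).sub ((hDi k).const_mul τ)).aestronglyMeasurable)
        aestronglyMeasurable_const ?_
      have : ∀ k, eLpNorm ((fun y => A k y - τ * D k y) - fun _ => (0 : ℝ)) 1 P =
          ENNReal.ofReal (a k / r k - τ * ∫ y, D k y ∂P) := fun k => by
        have hi : Integrable (fun y => A k y - τ * D k y) P := (hAi k).sub ((hDi k).const_mul τ)
        rw [← hdiff, ofReal_integral_eq_lintegral_ofReal hi (hDA k), eLpNorm_one_eq_lintegral_enorm]
        refine lintegral_congr_ae ?_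
        filter_upwards [hDA k] with y hy
        simp only [Pi.sub_apply, sub_zero]
        exact Real.enorm_of_nonneg hy
      simp only [this]
      simpa using ENNReal.tendsto_ofReal hlim
    obtain ⟨n, hn, hae⟩ := hmeas.exists_seq_tendsto_ae
    obtain ⟨b, v, hbv⟩ := exists_affine_of_tendsto
      {y | Tendsto (fun i => A (n i) y - τ * D (n i) y) atTop (𝓝 0)} x
      (fun i => a (n i) / r (n i)) (fun i => (r (n i))⁻¹ • g (n i))
      (fun y => τ * negSlope x ω y) (fun y hy => by
        have h2 := hy.add (((hDlim y).comp hn.tendsto_atTop).const_mul τ)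
        simpa [hA, Function.comp_def] using h2)
    exact ⟨b, v, hae.mono hbv⟩

end Slope

/-! ### A convexity criterion for extreme points -/

section ExtremePoints

variable {E : Type*} [NormedAddCommGroup E] [InnerProductSpace ℝ E]

/-- A set mapped to the unit sphere by an affine map `A`, in such a way that each of its points `y`
lies on the line through `x` in the direction `A y`, consists of extreme points of its convex hull
if no unit vector is a supporting functional of the ball at `A x`. -/
theorem mem_extremePoints_convexHull_of_affine {S : Set E} {x c : E} {T : E →L[ℝ] E}
    (hS : ∀ y ∈ S, ‖c + T (y - x)‖ = 1 ∧ ∃ t : ℝ, y = x - t • (c + T (y - x)))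
    (hc : ∀ e : E, ‖e‖ = 1 → inner ℝ c e ≠ 1) {y : E} (hy : y ∈ S) :
    y ∈ (convexHull ℝ S).extremePoints ℝ := by
  obtain ⟨he, s, hs⟩ := hS y hy
  set e : E := c + T (y - x) with hedef
  let φ : E → ℝ := fun z => inner ℝ (c + T (z - x)) e
  have hφ : ∀ (a b : ℝ) (p q : E), a + b = 1 → φ (a • p + b • q) = a * φ p + b * φ q := by
    intro a b p q hab
    have h1 : c + T (a • p + b • q - x) = a • (c + T (p - x)) + b • (c + T (q - x)) := by
      have h2 : a • p + b • q - x = a • (p - x) + b • (q - x) := by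
        have : x = (a + b) • x := by rw [hab, one_smul]
        nth_rewrite 1 [this]
        module
      have h3 : c = (a + b) • c := by rw [hab, one_smul]
      rw [h2, map_add, map_smul, map_smul]
      nth_rewrite 1 [h3]
      module
    change inner ℝ (c + T (a • p + b • q - x)) e = _
    rw [h1, inner_add_left, real_inner_smul_left, real_inner_smul_left]
  -- A convex set containing `S` whose face `φ = 1` lies on one line: two unit vectors with inner
  -- product `1` coincide.
  let C : Set E := {z | φ z ≤ 1 ∧ (φ z = 1 → ∃ t : ℝ, z = x - t • e)}
  have hCconv : Convex ℝ C := by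
    intro p hp q hq a b ha hb hab
    have hpq := hφ a b p q hab
    refine ⟨by rw [hpq]; nlinarith [hp.1, hq.1], fun h => ?_⟩
    rcases ha.eq_or_lt with rfl | ha
    · rw [zero_add] at hab
      subst hab
      simp only [zero_smul, one_smul, zero_add] at h ⊢
      exact hq.2 h
    rcases hb.eq_or_lt with rfl | hb
    · rw [add_zero] at hab
      subst hab
      simp only [zero_smul, one_smul, add_zero] at h ⊢
      exact hp.2 h
    have h1 : φ p = 1 := le_antisymm hp.1 (by nlinarith [hq.1])
    have h2 : φ q = 1 := le_antisymm hq.1 (by nlinarith [hp.1])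
    obtain ⟨t, ht⟩ := hp.2 h1
    obtain ⟨u, hu⟩ := hq.2 h2
    refine ⟨a * t + b * u, ?_⟩
    have : x = (a + b) • x := by rw [hab, one_smul]
    rw [ht, hu]
    nth_rewrite 3 [this]
    module
  have hSC : S ⊆ C := by
    intro z hz
    obtain ⟨hz1, t, ht⟩ := hS z hz
    refine ⟨(real_inner_le_norm _ _).trans (by rw [hz1, he, mul_one]), fun h => ⟨t, ?_⟩⟩
    rw [← (inner_eq_one_iff_of_norm_eq_one hz1 he).1 h]
    exact ht
  have hhull : convexHull ℝ S ⊆ C := convexHull_min hSC hCconv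
  have hφy : φ y = 1 := by
    simp only [φ, ← hedef]
    rw [real_inner_self_eq_norm_sq, he, one_pow]
  rw [mem_extremePoints]
  refine ⟨subset_convexHull ℝ S hy, fun p hp q hq hyo => ?_⟩
  obtain ⟨a, b, ha, hb, hab, rfl⟩ := hyo
  have hpC := hhull hp
  have hqC := hhull hq
  rw [hφ a b p q hab] at hφy
  have h1 : φ p = 1 := le_antisymm hpC.1 (by nlinarith [hqC.1])
  have h2 : φ q = 1 := le_antisymm hqC.1 (by nlinarith [hpC.1])
  obtain ⟨t, ht⟩ := hpC.2 h1
  obtain ⟨u, hu⟩ := hqC.2 h2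
  have htu : t = u := by
    by_contra hne
    have hne' : t - u ≠ 0 := sub_ne_zero.2 hne
    -- Two distinct points of that line span it, so `x` is an affine combination of them and `φ x =
    -- 1`, which `hc` forbids.
    have hx : (-u / (t - u)) • p + (t / (t - u)) • q = x := by
      have h3 : -u / (t - u) + t / (t - u) = 1 := by field_simp; ring
      have h4 : -u / (t - u) * t + t / (t - u) * u = 0 := by field_simp; ring
      calc _ = (-u / (t - u) + t / (t - u)) • x - (-u / (t - u) * t + t / (t - u) * u) • e := by
            rw [ht, hu]; module
        _ = x := by rw [h3, h4]; simp
    have hφx : φ x = 1 := by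
      rw [← hx, hφ _ _ p q (by field_simp; ring), h1, h2]
      field_simp; ring
    apply hc e he
    simpa [φ] using hφx
  have hpq : p = q := by rw [ht, hu, htu]
  subst hpq
  rw [← add_smul, hab, one_smul]
  exact ⟨rfl, rfl⟩

end ExtremePoints

/-! ### From affine unit vectors to extreme support -/

section Geometry

variable {E : Type*} [NormedAddCommGroup E] [InnerProductSpace ℝ E] [MeasurableSpace E]
  [FiniteDimensional ℝ E]

theorem exists_affine_of_forall_inner {P : Measure E} {x : E} {f : E → E}
    (h : ∀ ω : E, ∃ (b : ℝ) (v : E), ∀ᵐ y ∂P, inner ℝ (f y) ω = b + inner ℝ v (y - x)) :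
    ∃ (c : E) (T : E →L[ℝ] E), ∀ᵐ y ∂P, f y = c + T (y - x) := by
  choose b v hbv using h
  let e := stdOrthonormalBasis ℝ E
  refine ⟨∑ i, b (e i) • e i, ∑ i, (innerSL ℝ (v (e i))).smulRight (e i), ?_⟩
  filter_upwards [ae_all_iff.2 fun i => hbv (e i)] with y hy
  simp only [sum_apply, ContinuousLinearMap.smulRight_apply,
    innerSL_apply_apply, ← Finset.sum_add_distrib, ← add_smul, ← hy]
  rw [← e.sum_repr' (f y)]
  simp only [e.sum_repr', real_inner_comm]

variable [BorelSpace E]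

/-- The mean of the unit vectors pointing to the barycenter has norm less than one, in the form
that it is not the maximum point of any unit functional. -/
theorem inner_integral_unitVec_ne_one {P : Measure E} [IsProbabilityMeasure P]
    (hint : Integrable (fun y => y) P) {x : E} (hbar : ∫ y, y ∂P = x) (hatom : P {x} = 0)
    {e : E} (he : ‖e‖ = 1) : inner ℝ (∫ y, unitVec x y ∂P) e ≠ 1 := by
  intro h1
  have hne : ∀ᵐ y ∂P, y ≠ x := measure_eq_zero_iff_ae_notMem.1 hatom
  have hui : Integrable (fun y => inner ℝ (unitVec x y) e) P :=
    (integrable_unitVec P x).inner_const e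
  have hle : ∀ y, inner ℝ (unitVec x y) e ≤ 1 := fun y => by
    refine (real_inner_le_norm _ _).trans ?_
    rw [he, mul_one]
    exact norm_unitVec_le x y
  have hI : ∫ y, inner ℝ (unitVec x y) e ∂P = 1 := by
    simp_rw [real_inner_comm e]
    rw [integral_inner (integrable_unitVec P x) e, real_inner_comm, h1]
  have h0 : ∫ y, (1 - inner ℝ (unitVec x y) e) ∂P = 0 := by
    rw [integral_sub (integrable_const 1) hui, hI]; simp
  have hae := (integral_eq_zero_iff_of_nonneg (fun y => sub_nonneg.2 (hle y))
    ((integrable_const 1).sub hui)).1 h0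
  have hxy : Integrable (fun y => x - y) P := (integrable_const x).sub hint
  -- A mean of `1` forces every unit vector to be `e`; the right side has mean `0`, so `P` would be
  -- concentrated at `x`.
  have hnorm : ∀ᵐ y ∂P, ‖x - y‖ = inner ℝ e (x - y) := by
    filter_upwards [hae, hne] with y hy hyx
    have hy' : inner ℝ (unitVec x y) e = 1 := (sub_eq_zero.1 hy).symm
    have : ‖x - y‖ ≠ 0 := norm_ne_zero_iff.2 (sub_ne_zero.2 (Ne.symm hyx))
    rw [unitVec, inner_smul_left, conj_trivial, inv_mul_eq_iff_eq_mul₀ this, mul_one] at hy'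
    rw [real_inner_comm, hy']
  have hz : ∫ y, ‖x - y‖ ∂P = 0 := by
    rw [integral_congr_ae hnorm, integral_inner hxy e, integral_sub (integrable_const x) hint, hbar]
    simp
  have hz' := (integral_eq_zero_iff_of_nonneg (fun y => norm_nonneg (x - y)) hxy.norm).1 hz
  obtain ⟨y, hy, hyx⟩ := (hz'.and hne).exists
  exact hyx (sub_eq_zero.1 (norm_eq_zero.1 hy)).symm

/-- If the unit vectors pointing to the barycenter depend affinely on the base point, then the
support consists of the extreme points of its convex hull. -/
theorem support_eq_extremePoints_of_affine {P : Measure E} [IsProbabilityMeasure P]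
    (hint : Integrable (fun y => y) P) {x : E} (hbar : ∫ y, y ∂P = x) (hatom : P {x} = 0)
    (haff : ∀ ω : E, ∃ (b : ℝ) (v : E), ∀ᵐ y ∂P,
      inner ℝ (unitVec x y) ω = b + inner ℝ v (y - x)) :
    P.support = (convexHull ℝ P.support).extremePoints ℝ := by
  obtain ⟨c, T, hT⟩ := exists_affine_of_forall_inner haff
  have hne : ∀ᵐ y ∂P, y ≠ x := measure_eq_zero_iff_ae_notMem.1 hatom
  have hsub : Integrable (fun y => y - x) P := hint.sub (integrable_const x)
  have hc : ∫ y, unitVec x y ∂P = c := by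
    rw [integral_congr_ae hT, integral_add (integrable_const c) (T.integrable_comp hsub),
      T.integral_comp_comm hsub, integral_sub hint (integrable_const x), hbar]
    simp
  have hunit : ∀ᵐ y ∂P, ‖c + T (y - x)‖ = 1 := by
    filter_upwards [hT, hne] with y hy hyx
    have : ‖x - y‖ ≠ 0 := norm_ne_zero_iff.2 (sub_ne_zero.2 (Ne.symm hyx))
    rw [← hy, unitVec, norm_smul, norm_inv, norm_norm, inv_mul_cancel₀ this]
  have hray : ∀ᵐ y ∂P, y = x - ‖x - y‖ • (c + T (y - x)) := by
    filter_upwards [hT, hne] with y hy hyx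
    have : ‖x - y‖ ≠ 0 := norm_ne_zero_iff.2 (sub_ne_zero.2 (Ne.symm hyx))
    rw [← hy, unitVec, smul_smul, mul_inv_cancel₀ this, one_smul, sub_sub_cancel]
  have hS1 : P.support ⊆ {y | ‖c + T (y - x)‖ = 1} :=
    Measure.support_subset_of_isClosed (isClosed_eq (by fun_prop) (by fun_prop)) hunit
  have hS2 : P.support ⊆ {y | y = x - ‖x - y‖ • (c + T (y - x))} :=
    Measure.support_subset_of_isClosed (isClosed_eq (by fun_prop) (by fun_prop)) hray
  refine Subset.antisymm (fun y hy => ?_) extremePoints_convexHull_subset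
  exact mem_extremePoints_convexHull_of_affine (fun z hz => ⟨hS1 hz, _, hS2 hz⟩)
    (fun e he => hc ▸ inner_integral_unitVec_ne_one hint hbar hatom he) hy

end Geometry

/-! ### Touching duals and differentiation in the base point -/

section Touching

variable {E : Type*} [NormedAddCommGroup E] [InnerProductSpace ℝ E] [MeasurableSpace E]
  [FiniteDimensional ℝ E]

/-- A dual triple with vanishing duality gap is touched almost everywhere. -/
theorem ae_touching_of_integral_eq {μ : Measure E} [IsProbabilityMeasure μ] {κ : Kernel E E}
    [IsMarkovKernel κ] {B : Set E} (hB : MeasurableSet B)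
    (hbar : ∀ᵐ x ∂μ, Integrable (fun y => y) (κ x) ∧ ∫ y, y ∂κ x = x)
    {α β : E → ℝ} {γ : E → E} {c : E → E → ℝ}
    (hle : ∀ x ∈ B, ∀ y, β y - α x - inner ℝ (γ x) (y - x) ≤ c x y)
    (hβ : Integrable β (((μ ⊗ₘ κ).restrict (B ×ˢ univ)).map Prod.snd))
    (hα : Integrable α (((μ ⊗ₘ κ).restrict (B ×ˢ univ)).map Prod.fst))
    (hc : Integrable (fun p => c p.1 p.2) ((μ ⊗ₘ κ).restrict (B ×ˢ univ)))
    (hgap : ∫ y, β y ∂(((μ ⊗ₘ κ).restrict (B ×ˢ univ)).map Prod.snd) -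
      ∫ x, α x ∂(((μ ⊗ₘ κ).restrict (B ×ˢ univ)).map Prod.fst) =
      ∫ p, c p.1 p.2 ∂((μ ⊗ₘ κ).restrict (B ×ˢ univ))) :
    ∀ᵐ x ∂μ, x ∈ B → ∀ᵐ y ∂κ x, β y - α x - inner ℝ (γ x) (y - x) = c x y := by
  have hres : (μ ⊗ₘ κ).restrict (B ×ˢ univ) = (μ.restrict B) ⊗ₘ κ := by
    ext s hs
    rw [Measure.restrict_apply hs, Measure.compProd_apply (hs.inter (hB.prod .univ)),
      Measure.compProd_apply hs, ← lintegral_indicator hB]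
    refine lintegral_congr fun x => ?_
    by_cases hx : x ∈ B
    · rw [indicator_of_mem hx]
      congr 1
      ext y
      simp [hx]
    · rw [indicator_of_notMem hx, measure_eq_zero_iff_ae_notMem]
      exact Eventually.of_forall fun y hy => hx hy.2.1
  rw [hres] at hβ hα hc hgap
  rw [integral_map measurable_snd.aemeasurable hβ.aestronglyMeasurable,
    integral_map measurable_fst.aemeasurable hα.aestronglyMeasurable] at hgap
  have hβ' : Integrable (fun p : E × E => β p.2) (μ.restrict B ⊗ₘ κ) :=
    hβ.comp_measurable measurable_snd
  have hα' : Integrable (fun p : E × E => α p.1) (μ.restrict B ⊗ₘ κ) :=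
    hα.comp_measurable measurable_fst
  set H : E × E → ℝ := fun p => c p.1 p.2 - (β p.2 - α p.1) with hHdef
  have hH : Integrable H (μ.restrict B ⊗ₘ κ) := hc.sub (hβ'.sub hα')
  have hHint : ∫ p, H p ∂(μ.restrict B ⊗ₘ κ) = 0 := by
    have : Integrable (fun p : E × E => β p.2 - α p.1) (μ.restrict B ⊗ₘ κ) := hβ'.sub hα'
    rw [integral_sub hc this, integral_sub hβ' hα', ← hgap, sub_self]
  rw [Measure.integral_compProd hH] at hHint
  have hHx := ((Measure.integrable_compProd_iff hH.aestronglyMeasurable).1 hH).1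
  have hgap0 : ∀ x, ∀ y, H (x, y) + inner ℝ (γ x) (y - x) =
      c x y - (β y - α x - inner ℝ (γ x) (y - x)) := fun x y => by simp only [hHdef]; ring
  -- The `γ` term is integrated fibre by fibre, since it need not be integrable for the whole plan.
  have hmean : ∀ᵐ x ∂μ.restrict B, Integrable (fun y => 0 + inner ℝ (γ x) (y - x)) (κ x) ∧
      ∫ y, H (x, y) + (0 + inner ℝ (γ x) (y - x)) ∂κ x = ∫ y, H (x, y) ∂κ x := by
    filter_upwards [ae_restrict_of_ae hbar, hHx] with x hx hHx
    have hi := integrable_affine hx.1 x 0 (γ x)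
    refine ⟨hi, ?_⟩
    rw [integral_add hHx hi, integral_affine hx.1 hx.2, add_zero]
  simp only [zero_add] at hmean
  have hnonneg : 0 ≤ᵐ[μ.restrict B] fun x => ∫ y, H (x, y) ∂κ x := by
    filter_upwards [hmean, ae_restrict_mem hB] with x hx hxB
    rw [Pi.zero_apply, ← hx.2]
    refine integral_nonneg fun y => ?_
    rw [hgap0]
    exact sub_nonneg.2 (hle x hxB y)
  have hHI : Integrable (fun x => ∫ y, H (x, y) ∂κ x) (μ.restrict B) := by
    have h := hH
    rw [Measure.compProd] at h
    simpa using h.integral_compProd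
  have hzero := (integral_eq_zero_iff_of_nonneg_ae hnonneg hHI).1 hHint
  refine ae_imp_of_ae_restrict ?_
  filter_upwards [hmean, hHx, hzero, ae_restrict_mem hB] with x hx hHx hz hxB
  rw [Pi.zero_apply] at hz
  have h0 : ∫ y, H (x, y) + inner ℝ (γ x) (y - x) ∂κ x = 0 := by rw [hx.2, hz]
  have hae := (integral_eq_zero_iff_of_nonneg (fun y => by
    change 0 ≤ H (x, y) + inner ℝ (γ x) (y - x)
    rw [hgap0]; exact sub_nonneg.2 (hle x hxB y)) (hHx.add hx.1)).1 h0
  filter_upwards [hae] with y hy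
  change H (x, y) + inner ℝ (γ x) (y - x) = 0 at hy
  rw [hgap0] at hy
  exact (sub_eq_zero.1 hy).symm

variable [BorelSpace E]

/-- At almost every point where an admissible triple for the cost `τ ‖x - y‖` is touched
by a probability measure centred at the point and, for `τ = 1`, not charging it, the support of
this measure consists of the extreme points of its convex hull. -/
theorem ae_support_eq_extremePoints_of_touching [Nontrivial E] (lam : Measure E)
    [lam.IsAddHaarMeasure] {κ : E → Measure E} [∀ x, IsProbabilityMeasure (κ x)] {G : Set E}
    {α β : E → ℝ} {γ : E → E} {τ : ℝ} (hτ : τ = 1 ∨ τ = -1)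
    (hint : ∀ x ∈ G, Integrable (fun y => y) (κ x)) (hbar : ∀ x ∈ G, ∫ y, y ∂κ x = x)
    (hle : ∀ x ∈ G, ∀ y, β y - α x - inner ℝ (γ x) (y - x) ≤ τ * ‖x - y‖)
    (heq : ∀ x ∈ G, ∀ᵐ y ∂κ x, β y - α x - inner ℝ (γ x) (y - x) = τ * ‖x - y‖)
    (hatom : τ = 1 → ∀ x ∈ G, κ x {x} = 0) :
    ∀ᵐ x ∂lam, x ∈ G → (κ x).support = (convexHull ℝ (κ x).support).extremePoints ℝ := by
  have hincr : ∀ x ∈ G, ∀ x' ∈ G, ∀ᵐ y ∂κ x, τ * (‖x - y‖ - ‖x' - y‖) ≤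
      (α x' - α x - inner ℝ (γ x') (x' - x)) + inner ℝ (γ x' - γ x) (y - x) := by
    intro x hx x' hx'
    filter_upwards [heq x hx] with y hy
    have h1 := hle x' hx' y
    have h2 : y - x' = (y - x) - (x' - x) := by abel
    rw [h2, inner_sub_right] at h1
    rw [inner_sub_left]
    linarith
  have hτabs : |τ| = 1 := by rcases hτ with rfl | rfl <;> simp
  have hlow : ∀ x ∈ G, ∀ x' ∈ G, -‖x' - x‖ ≤ α x' - α x - inner ℝ (γ x') (x' - x) := by
    intro x hx x' hx'
    rw [← integral_affine (hint x hx) (hbar x hx) (α x' - α x - inner ℝ (γ x') (x' - x))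
      (γ x' - γ x)]
    have h1 : ∫ _, -‖x' - x‖ ∂κ x = -‖x' - x‖ := by simp
    rw [← h1]
    refine integral_mono_ae (integrable_const _) (integrable_affine (hint x hx) x _ _) ?_
    filter_upwards [hincr x hx x' hx'] with y hy
    refine le_trans ?_ hy
    have h2 : |τ * (‖x - y‖ - ‖x' - y‖)| ≤ ‖x' - x‖ := by
      rw [abs_mul, hτabs, one_mul]
      refine (abs_norm_sub_norm_le _ _).trans (le_of_eq ?_)
      rw [sub_sub_sub_cancel_right, norm_sub_rev]
    exact (abs_le.1 h2).1
  have hlip : ∀ n : ℕ, LipschitzOnWith (n + 1) α (G ∩ {x | ‖γ x‖ ≤ n}) := by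
    refine fun n => LipschitzOnWith.of_le_add_mul _ fun x hx x' hx' => ?_
    have h1 := hlow x hx.1 x' hx'.1
    have h2 : -inner ℝ (γ x') (x' - x) ≤ n * ‖x' - x‖ :=
      (neg_le_abs _).trans ((abs_real_inner_le_norm _ _).trans
        (mul_le_mul_of_nonneg_right hx'.2 (norm_nonneg _)))
    rw [dist_eq_norm, norm_sub_rev]
    push_cast
    linarith
  have hdiff := ae_all_iff.2 fun n : ℕ => (hlip n).ae_differentiableWithinAt_of_mem (μ := lam)
  have hdir := ae_all_iff.2 fun n : ℕ =>
    ae_exists_seq_tendsto_direction lam (G ∩ {x | ‖γ x‖ ≤ n}) γ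
  filter_upwards [hdiff, hdir] with x hdx hsx hxG
  obtain ⟨n, hn⟩ := exists_nat_ge ‖γ x‖
  have hxn : x ∈ G ∩ {x | ‖γ x‖ ≤ n} := ⟨hxG, hn⟩
  have hf := (hdx n hxn).hasFDerivWithinAt
  set f := fderivWithin ℝ α (G ∩ {x | ‖γ x‖ ≤ n}) x
  have hslope : ∀ ω : E, τ * ∫ y, negSlope x ω y ∂κ x ≤ f ω - inner ℝ (γ x) ω ∧
      (τ * ∫ y, negSlope x ω y ∂κ x = f ω - inner ℝ (γ x) ω →
        ∃ (b : ℝ) (v : E), ∀ᵐ y ∂κ x, τ * negSlope x ω y = b + inner ℝ v (y - x)) := by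
    intro ω
    obtain ⟨w, r, hr, hr0, hw, hmem, hγ⟩ := hsx n hxn ω
    refine slope_le_and_affine_of_eq (hint x hxG) (hbar x hxG) τ hr hr0 hw
      (a := fun k => α (x + r k • w k) - α x - inner ℝ (γ (x + r k • w k)) (x + r k • w k - x))
      (g := fun k => γ (x + r k • w k) - γ x) ?_ (fun k => hincr x hxG _ (hmem k).1)
    have h1 : Tendsto (fun k => r k • w k) atTop (𝓝 0) := by simpa using hr0.smul hw
    have h2 : ∀ k, (r k)⁻¹ • (r k • w k) = w k := fun k => inv_smul_smul₀ (hr k).ne' _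
    have h3 := hf.lim (c := fun k => (r k)⁻¹) h1 (Eventually.of_forall hmem) (by simpa only [h2])
    refine (h3.sub (hγ.inner hw)).congr fun k => ?_
    rw [add_sub_cancel_left, inner_smul_right, smul_eq_mul]
    have := (hr k).ne'
    field_simp
  simp_rw [integral_negSlope] at hslope
  set u := ∫ y, unitVec x y ∂κ x
  have hatomx : κ x {x} = 0 := by
    -- For `τ = -1` the atom contributes `+ (κ x).real {x} * ‖ω‖` to the left side; adding the
    -- inequalities for `ω` and `-ω` makes it nonpositive.
    rcases hτ with hτ | rfl
    · exact hatom hτ x hxG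
    · obtain ⟨ω, hω⟩ := exists_ne (0 : E)
      have h1 := (hslope ω).1
      have h2 := (hslope (-ω)).1
      simp only [inner_neg_right, map_neg, norm_neg] at h2
      have h3 : (κ x).real {x} * ‖ω‖ ≤ 0 := by linarith
      have h4 : (κ x).real {x} ≤ 0 := nonpos_of_mul_nonpos_left h3 (norm_pos_iff.2 hω)
      exact (measureReal_eq_zero_iff).1 (le_antisymm h4 measureReal_nonneg)
  refine support_eq_extremePoints_of_affine (hint x hxG) (hbar x hxG) hatomx fun ω => ?_
  have hreal : (κ x).real {x} = 0 := by rw [measureReal_def, hatomx, ENNReal.toReal_zero]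
  simp only [hreal, zero_mul, sub_zero] at hslope
  have h2 := (hslope (-ω)).1
  simp only [inner_neg_right, map_neg] at h2
  obtain ⟨b, v, hbv⟩ := (hslope ω).2 (le_antisymm (hslope ω).1 (by linarith))
  refine ⟨-τ * b, -τ • v, ?_⟩
  filter_upwards [hbv, measure_eq_zero_iff_ae_notMem.1 hatomx] with y hy hyx
  rw [negSlope, indicator_of_notMem hyx, sub_zero] at hy
  rw [real_inner_smul_left]
  have hτ2 : τ * τ = 1 := by rcases hτ with rfl | rfl <;> norm_num
  linear_combination (-(inner ℝ (unitVec x y) ω)) * hτ2 - τ * hy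

end Touching

/-- A set `N` that is null for `μ` carries the second marginal, so `κ x` lives on `N` for a.e. `x`,
while a.e. `x` lies outside `N`. -/
theorem ae_singleton_eq_zero_of_mutuallySingular {E : Type*} [MeasurableSpace E]
    {μ : Measure E} [SFinite μ] {κ : Kernel E E} [IsSFiniteKernel κ]
    (h : μ ⟂ₘ (μ ⊗ₘ κ).map Prod.snd) : ∀ᵐ x ∂μ, κ x {x} = 0 := by
  obtain ⟨N, hN, hμN, hνN⟩ := h
  rw [Measure.map_apply measurable_snd hN.compl] at hνN
  have h1 : ∀ᵐ x ∂μ, ∀ᵐ y ∂κ x, y ∈ N :=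
    Measure.ae_ae_of_ae_compProd (p := fun p : E × E => p.2 ∈ N) hνN
  filter_upwards [h1, measure_eq_zero_iff_ae_notMem.1 hμN] with x hx hxN
  refine measure_mono_null ?_ hx
  rintro y rfl
  exact hxN

end MartingaleTransport

/-! ### Reduction to one sign and conclusion -/

theorem theorem5p4 {d : ℕ}
    (μ ν : Measure (EuclideanSpace ℝ (Fin d))) [IsProbabilityMeasure μ] [IsProbabilityMeasure ν]
    (hμ_moment : Integrable (fun x => x) μ) (hν_moment : Integrable (fun y => y) ν)
    (hμ : μ ≪ volume)
    (σ : ℝ) (hσ : σ = 1 ∨ σ = -1) (s : Sense)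
    (hsing : (s = Sense.minimize ∧ σ = 1) ∨ (s = Sense.maximize ∧ σ = -1) → μ ⟂ₘ ν)
    (π : Measure (EuclideanSpace ℝ (Fin d) × EuclideanSpace ℝ (Fin d)))
    (hπ : IsOptimal s (distCost σ) μ ν π)
    (B : Set (EuclideanSpace ℝ (Fin d))) (hB : MeasurableSet B)
    (hdual : AdmitsDual s (distCost σ) π B)
    (κ : Kernel (EuclideanSpace ℝ (Fin d)) (EuclideanSpace ℝ (Fin d)))
    (hκ : IsDisintegration π μ κ) :
    ∀ᵐ x ∂μ, x ∈ B →
      (κ x).support = (convexHull ℝ (κ x).support).extremePoints ℝ := by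
  obtain ⟨hMarkov, rfl⟩ := hκ
  obtain ⟨⟨-, -, hsnd, κ', ⟨hMarkov', hκκ'⟩, hbar'⟩, -⟩ := hπ
  -- Disintegrations are a.e. unique, so the barycenter property passes from `κ'` to `κ`.
  have hbar : ∀ᵐ x ∂μ, Integrable (fun y => y) (κ x) ∧ ∫ y, y ∂κ x = x := by
    filter_upwards [hbar', Kernel.ae_eq_of_compProd_eq hκκ'] with x hx hxκ
    rwa [hxκ]
  obtain ⟨α, γ, β, τ, hτ, hτσ, hle, hβ, hα, hc, hgap⟩ : ∃ (α : EuclideanSpace ℝ (Fin d) → ℝ)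
      (γ : EuclideanSpace ℝ (Fin d) → EuclideanSpace ℝ (Fin d))
      (β : EuclideanSpace ℝ (Fin d) → ℝ) (τ : ℝ), (τ = 1 ∨ τ = -1) ∧
      (τ = 1 → (s = Sense.minimize ∧ σ = 1) ∨ (s = Sense.maximize ∧ σ = -1)) ∧
      (∀ x ∈ B, ∀ y, β y - α x - inner ℝ (γ x) (y - x) ≤ distCost τ x y) ∧
      Integrable β ((restrictPlan (μ ⊗ₘ κ) B).map Prod.snd) ∧
      Integrable α ((restrictPlan (μ ⊗ₘ κ) B).map Prod.fst) ∧
      Integrable (fun p => distCost τ p.1 p.2) (restrictPlan (μ ⊗ₘ κ) B) ∧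
      ∫ y, β y ∂((restrictPlan (μ ⊗ₘ κ) B).map Prod.snd) -
        ∫ x, α x ∂((restrictPlan (μ ⊗ₘ κ) B).map Prod.fst) =
        ∫ p, distCost τ p.1 p.2 ∂(restrictPlan (μ ⊗ₘ κ) B) := by
    obtain ⟨α, γ, β, hadm, hβ, hα, hc, hgap⟩ := hdual
    cases s with
    | minimize =>
      exact ⟨α, γ, β, σ, hσ, fun h => Or.inl ⟨rfl, h⟩, fun x hx y => hadm.ineq x hx y (mem_univ y),
        hβ, hα, hc, hgap⟩
    | maximize =>
      have hneg : ∀ x y : EuclideanSpace ℝ (Fin d), distCost (-σ) x y = -distCost σ x y :=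
        fun x y => neg_mul _ _
      refine ⟨fun x => -α x, fun x => -γ x, fun y => -β y, -σ, ?_,
        fun h => Or.inr ⟨rfl, by linarith⟩, fun x hx y => ?_, hβ.neg, hα.neg, ?_, ?_⟩
      · rcases hσ with rfl | rfl <;> simp
      · have h : distCost σ x y ≤ β y - α x - inner ℝ (γ x) (y - x) := hadm.ineq x hx y (mem_univ y)
        rw [hneg, inner_neg_left]
        linarith
      · simp_rw [hneg]
        exact hc.neg
      · simp_rw [hneg, integral_neg, ← hgap]
        ring
  have htouch := ae_touching_of_integral_eq hB hbar hle hβ hα hc hgap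
  -- The case `d = 0` has no nonzero direction with which to exclude atoms.
  rcases subsingleton_or_nontrivial (EuclideanSpace ℝ (Fin d)) with hd | hd
  · refine Filter.Eventually.of_forall fun x _ => Subset.antisymm (fun y hy => ?_)
      extremePoints_convexHull_subset
    exact mem_extremePoints.2 ⟨subset_convexHull ℝ _ hy,
      fun _ _ _ _ _ => ⟨Subsingleton.elim _ _, Subsingleton.elim _ _⟩⟩
  have hatom : ∀ᵐ x ∂μ, τ = 1 → κ x {x} = 0 := by
    by_cases h : τ = 1
    · have := ae_singleton_eq_zero_of_mutuallySingular (hsnd.symm ▸ hsing (hτσ h))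
      filter_upwards [this] with x hx _ using hx
    · exact Filter.Eventually.of_forall fun x h' => absurd h' h
  have key := ae_support_eq_extremePoints_of_touching volume (κ := κ)
    (G := {x | x ∈ B ∧ (Integrable (fun y => y) (κ x) ∧ ∫ y, y ∂κ x = x) ∧
      (∀ᵐ y ∂κ x, β y - α x - inner ℝ (γ x) (y - x) = distCost τ x y) ∧ (τ = 1 → κ x {x} = 0)})
    hτ (fun x hx => hx.2.1.1) (fun x hx => hx.2.1.2) (fun x hx => hle x hx.1)
    (fun x hx => hx.2.2.1) (fun h x hx => hx.2.2.2 h)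
  filter_upwards [hμ.ae_le key, hbar, htouch, hatom] with x hx h1 h2 h3 hxB
  exact hx ⟨hxB, h1, h2 hxB, h3⟩
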